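/- **Conventions.** Let $(T,+)$ be a Hausdorff semitopological semigroup (not necessarily commutative; all left and right translations are continuous), and let $\tau_x$ be the set of neighbourhoods of $x$. For a subsemigroup $S$ of $T$, $\beta S$ is the set of ultrafilters on $S$, with $A\in p+q\iff\{s\in S:\{t\in S:s+t\in A\}\in q\}\in p$. For an idempotent $e\in T\setminus S$, $S$ is a *near $e$ subsemigroup* of $T$ if $e\in cl_T(S)$; then $e_S^*=\{p\in\beta S: e\in cl_T(A)\text{ for all }A\in p\}$ is a subsemigroup of $\beta S$ with a smallest (two-sided) ideal $K(e_S^*)$. A set $A\subseteq S$ is: * *central near $e$* if $A\in p$ for some $p\in K(e_S^*)$ with $p+p=p$; * *piecewise syndetic near $e$* (when $e$ has a countable local base) if, for a decreasing countable local base $(W_n)$ at $e$ (the choice does not matter), there are finite nonempty $F_n\subseteq W_n\cap S$ and $V_n\in\tau_e$ with $V_n\subseteq W_n$ such that for every finite nonempty $G\subseteq S$ and every $O\in\tau_e$ there is $x\in O\cap S$ such that for all $n$ and all $y\in G\cap V_n$ there is $t\in F_n$ with $t+y+x\in A$; * *IP near $e$* if there is a sequence $(x_n)_{n\ge1}$ in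 $S$ such that $FS((x_n)_{n\ge 1})\subseteq A$ and every $U\in\tau_e$ contains $FS((x_n)_{n\ge m})$ for some $m$, where $FS$ denotes the set of all sums over finite nonempty index sets, taken in increasing order of indices; * *central\** (resp. *PS\**, *IP\**) *near $e$* if $A$ intersects every subset of $S$ that is central (resp. piecewise syndetic, IP) near $e$. For $l\ge1$, $T^l$ carries the product topology and coordinatewise addition, and $\overline a=(a,\dots,a)$. The same notions are used for subsemigroups of $T^l$ near $\overline e$. **Theorem.** Let $S$ be a near $e$ subsemigroup of $T$, let $l\ge1$, and let $E^\Diamond\subseteq S^l$ be a near $\overline e$ subsemigroup of $T^l$ with $\{\overline a:a\in S\}\subseteq E^\Diamond$. Let $I^\Diamond$ be a (two-sided) ideal of $E^\Diamond$ that is also a near $\overline e$ subsemigroup of $T^l$. Assume that for each $i\in\{1,\dots,l\}$, with $\pi_i:I^\Diamond\to\pi_i[I^\Diamond]$ the projection onto the $i$-th coordinate, every $\mathcal E_i\subseteq\pi_i[I^\Diamond]$ with $e\in cl_T(\mathcal E_i)$ satisfies $\overline e\in cl_{T^l}(\pi_i^{-1}(\mathcal E_i))$. Let $B\subseteq S$.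 Then: 1. If $B$ is central near $e$ in $S$, then $B^l\cap I^\Diamond$ is central near $\overline e$ in $I^\Diamond$. 2. If $e$ has a countable local base in $T$ and $B$ is piecewise syndetic near $e$ in $S$, then $B^l\cap I^\Diamond$ is piecewise syndetic near $\overline e$ in $I^\Diamond$. 3. If $e$ has a countable local base in $T$ and $B$ is central\* near $e$ in $S$, then $B^l\cap I^\Diamond$ is central\* near $\overline e$ in $I^\Diamond$. 4. If $e$ has a countable local base in $T$ and $B$ is PS\* near $e$ in $S$, then $B^l\cap I^\Diamond$ is PS\* near $\overline e$ in $I^\Diamond$. 5. If $B$ is IP\* near $e$ in $S$, then $B^l\cap I^\Diamond$ is IP\* near $\overline e$ in $I^\Diamond$. -/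

import Mathlib

/-!
Notions of largeness near an idempotent `e` of a semitopological semigroup `(T, +)`, for a
subsemigroup `S` of `T` (with `e ∉ S` and `e` in the closure of `S`).  Subsets of `S` are
represented as sets in `T` that are contained in `S`; the compactification `βS` of the discrete
semigroup `S` is `Ultrafilter S`, with Mathlib's addition
`A ∈ p + q ↔ {s | {t | s + t ∈ A} ∈ q} ∈ p`.
-/

namespace NearIdempotent

open Set Filter Topology

/-- `J` is a (nonempty, two-sided) ideal of `P`. -/
structure IsIdealOf {G : Type*} [Add G] (J P : Set G) : Prop where
  nonempty : J.Nonempty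
  subset : J ⊆ P
  left_mem : ∀ p ∈ P, ∀ j ∈ J, p + j ∈ J
  right_mem : ∀ p ∈ P, ∀ j ∈ J, j + p ∈ J

/-- `K(P)`, the smallest ideal of `P`: the elements of `P` that lie in every ideal of `P`. -/
def smallestIdeal {G : Type*} [Add G] (P : Set G) : Set G :=
  {p ∈ P | ∀ J : Set G, IsIdealOf J P → p ∈ J}

/-- `S` is a near `e` subsemigroup of `T`: `e` is an idempotent of `T` outside `S` that lies in the
closure of `S`. -/
structure IsNear {T : Type*} [AddSemigroup T] [TopologicalSpace T]
    (S : AddSubsemigroup T) (e : T) : Prop where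
  idem : e + e = e
  notMem : e ∉ S
  mem_closure : e ∈ closure (S : Set T)

/-- `e_S^*`: the ultrafilters on `S` all of whose members have `e` in their closure in `T`. -/
def nearUltrafilters {T : Type*} [AddSemigroup T] [TopologicalSpace T]
    (S : AddSubsemigroup T) (e : T) : Set (Ultrafilter S) :=
  {p | ∀ A ∈ p, e ∈ closure ((fun s : S => (s : T)) '' A)}

section Central

attribute [local instance] Ultrafilter.addSemigroup

/-- `A ⊆ S` is central near `e`: it is a member of an idempotent in `K(e_S^*)`. -/
def IsCentral {T : Type*} [AddSemigroup T] [TopologicalSpace T]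
    (S : AddSubsemigroup T) (e : T) (A : Set T) : Prop :=
  ∃ p ∈ smallestIdeal (nearUltrafilters S e), p + p = p ∧ {s : S | (s : T) ∈ A} ∈ p

end Central

/-- `A ⊆ S` is central* near `e`. -/
def IsCentralStar {T : Type*} [AddSemigroup T] [TopologicalSpace T]
    (S : AddSubsemigroup T) (e : T) (A : Set T) : Prop :=
  ∀ C ⊆ (S : Set T), IsCentral S e C → (A ∩ C).Nonempty

/-- `A ⊆ S` is piecewise syndetic near `e`, tested on the decreasing local base `W` at `e`. -/
def IsPiecewiseSyndeticWith {T : Type*} [AddSemigroup T] [TopologicalSpace T]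
    (S : AddSubsemigroup T) (e : T) (W : ℕ → Set T) (A : Set T) : Prop :=
  ∃ (F : ℕ → Finset T) (V : ℕ → Set T),
    (∀ n, (F n).Nonempty ∧ (F n : Set T) ⊆ W n ∩ S ∧ V n ∈ 𝓝 e ∧ V n ⊆ W n) ∧
    ∀ G : Finset T, G.Nonempty → (G : Set T) ⊆ S → ∀ O ∈ 𝓝 e,
      ∃ x ∈ O ∩ S, ∀ n, ∀ y ∈ (G : Set T) ∩ V n, ∃ t ∈ F n, t + (y + x) ∈ A

/-- `A ⊆ S` is piecewise syndetic near `e`, where `e` has a countable local base. -/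
def IsPiecewiseSyndetic {T : Type*} [AddSemigroup T] [TopologicalSpace T]
    (S : AddSubsemigroup T) (e : T) (A : Set T) : Prop :=
  ∃ W : ℕ → Set T, (𝓝 e).HasAntitoneBasis W ∧ IsPiecewiseSyndeticWith S e W A

/-- The choice of the local base does not matter. -/
theorem isPiecewiseSyndetic_iff {T : Type*} [AddSemigroup T] [TopologicalSpace T]
    (S : AddSubsemigroup T) (e : T) (A : Set T) (W : ℕ → Set T) (hW : (𝓝 e).HasAntitoneBasis W) :
    IsPiecewiseSyndetic S e A ↔ IsPiecewiseSyndeticWith S e W A := by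
  refine ⟨?_, fun h => ⟨W, hW, h⟩⟩
  rintro ⟨W', hW', F, V, hFV, h⟩
  have hk : ∀ k, ∃ n, W' n ⊆ W k := fun k => hW'.mem_iff.1 (hW.mem k)
  choose n hn using hk
  refine ⟨fun k => F (n k), fun k => V (n k), fun k => ?_, ?_⟩
  · obtain ⟨h1, h2, h3, h4⟩ := hFV (n k)
    exact ⟨h1, fun t ht => ⟨hn k (h2 ht).1, (h2 ht).2⟩, h3, h4.trans (hn k)⟩
  · intro G hG hGS O hO
    obtain ⟨x, hx, hx'⟩ := h G hG hGS O hO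
    exact ⟨x, hx, fun k => hx' (n k)⟩

/-- `A ⊆ S` is PS* near `e`. -/
def IsPSStar {T : Type*} [AddSemigroup T] [TopologicalSpace T]
    (S : AddSubsemigroup T) (e : T) (A : Set T) : Prop :=
  ∀ C ⊆ (S : Set T), IsPiecewiseSyndetic S e C → (A ∩ C).Nonempty

/-- The sum of the sequence `x` converges near `e`: every neighbourhood of `e` contains all finite
sums (in increasing order of indices) of some tail of `x`. -/
def SumConvergesNear {T : Type*} [AddSemigroup T] [TopologicalSpace T]
    (e : T) (x : Stream' T) : Prop :=
  ∀ U ∈ 𝓝 e, ∃ m, Hindman.FS (x.drop m) ⊆ U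

/-- `A ⊆ S` is IP near `e`. -/
def IsIP {T : Type*} [AddSemigroup T] [TopologicalSpace T]
    (S : AddSubsemigroup T) (e : T) (A : Set T) : Prop :=
  ∃ x : Stream' T, (∀ n, x.get n ∈ S) ∧ SumConvergesNear e x ∧ Hindman.FS x ⊆ A

/-- `A ⊆ S` is IP* near `e`. -/
def IsIPStar {T : Type*} [AddSemigroup T] [TopologicalSpace T]
    (S : AddSubsemigroup T) (e : T) (A : Set T) : Prop :=
  ∀ C ⊆ (S : Set T), IsIP S e C → (A ∩ C).Nonempty

end NearIdempotent

/-!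
The semigroup `e_S^*` is identified with the compact right topological semigroup
`convergentUltrafilters S e` of ultrafilters on `T` that contain `S` and converge to `e`, and its
smallest ideal `K` with the set of those `p` such that `p ∈ P + r + p` for all `r ∈ P`
(`smallestIdeal_eq_minimalPoints`).  Central sets near `e` are the members of idempotents of `K`;
if `e` has a countable local base, piecewise syndetic sets near `e` are the members of arbitrary
elements of `K` (`IsPiecewiseSyndetic.exists_mem_minimalPoints`,
`isPiecewiseSyndetic_of_mem_minimalPoints`).

For the first two parts one lifts: given an idempotent `p ∈ K(e_S^*)`, let `d` be its image under
the diagonal and `q` an idempotent of a minimal left ideal contained in the left ideal `P + d`,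
where `P` consists of the ultrafilters on `I` near `(e, …, e)`.  Every coordinate projection `π_i q`
is an idempotent of the minimal left ideal of `p`, so `p + π_i q = p`; hence `d + q` is an idempotent
of `K(P)` all of whose projections are `p` (`exists_idempotent_lift`).  An arbitrary element of
`K(e_S^*)` has a right identity among its idempotents, which reduces its lifting to that case.

For the dual notions central* and PS* one projects: by the hypothesis on projections every
ultrafilter on `π_i[I]` near `e` lifts to `I`, and therefore `π_i` maps `K(P)` into `K(e_S^*)`
(`map_eval_mem_minimalPoints`).  A central* (PS*) set belongs to all idempotents (elements) of
`K(e_S^*)`, so its power belongs to all idempotents (elements) of `K(P)`.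

The statement on IP* sets uses only idempotents: the finite sums of all tails of a sequence lie in a
common idempotent `q`, and if some `π_i q` missed `B`, then Hindman's construction, carried out
inside these tails, would produce a sequence in `S` whose sums converge to `e` and avoid `B`.
-/

namespace NearIdempotent

open Set Filter Topology

/-! ### The smallest ideal of a compact right topological semigroup -/

/-- The points `p` of `P` with `p ∈ P + r + p` for every `r ∈ P`.  In a compact right topological
semigroup these are the elements of the minimal left ideals; this elementary form is the one that
can be transported along homomorphisms. -/
def minimalPoints {G : Type*} [Add G] (P : Set G) : Set G :=
  {p ∈ P | ∀ r ∈ P, ∃ s ∈ P, s + (r + p) = p}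

section Algebra

variable {G : Type*} [AddSemigroup G] {P : Set G}

theorem add_mem_minimalPoints (hP : ∀ p ∈ P, ∀ q ∈ P, p + q ∈ P) {p q : G} (hq : q ∈ P)
    (hp : p ∈ minimalPoints P) : q + p ∈ minimalPoints P := by
  refine ⟨hP _ hq _ hp.1, fun r hr => ?_⟩
  obtain ⟨s, hs, h⟩ := hp.2 (r + q) (hP _ hr _ hq)
  refine ⟨q + s, hP _ hq _ hs, ?_⟩
  rw [add_assoc, ← add_assoc r, h]

theorem minimalPoints_add_mem (hP : ∀ p ∈ P, ∀ q ∈ P, p + q ∈ P) {p q : G} (hq : q ∈ P)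
    (hp : p ∈ minimalPoints P) : p + q ∈ minimalPoints P := by
  refine ⟨hP _ hp.1 _ hq, fun r hr => ?_⟩
  obtain ⟨s, hs, h⟩ := hp.2 r hr
  exact ⟨s, hs, by rw [← add_assoc r, ← add_assoc, h]⟩

theorem smallestIdeal_eq_minimalPoints (hP : ∀ p ∈ P, ∀ q ∈ P, p + q ∈ P)
    (hne : (minimalPoints P).Nonempty) : smallestIdeal P = minimalPoints P := by
  refine Subset.antisymm (fun p hp => hp.2 _ ⟨hne, fun _ h => h.1,
    fun p hp j hj => add_mem_minimalPoints hP hp hj,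
    fun p hp j hj => minimalPoints_add_mem hP hp hj⟩) (fun p hp => ⟨hp.1, fun J hJ => ?_⟩)
  obtain ⟨r, hr⟩ := hJ.nonempty
  obtain ⟨s, hs, h⟩ := hp.2 r (hJ.subset hr)
  rw [← h]
  exact hJ.left_mem _ hs _ (hJ.right_mem _ hp.1 _ hr)

theorem image_minimalPoints {H : Type*} [AddSemigroup H] (f : G → H) (hf : Function.Injective f)
    (hadd : ∀ p q, f (p + q) = f p + f q) (P : Set G) :
    f '' minimalPoints P = minimalPoints (f '' P) := by
  ext x
  constructor
  · rintro ⟨p, hp, rfl⟩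
    refine ⟨mem_image_of_mem f hp.1, ?_⟩
    rintro _ ⟨r, hr, rfl⟩
    obtain ⟨s, hs, h⟩ := hp.2 r hr
    exact ⟨f s, mem_image_of_mem f hs, by rw [← hadd, ← hadd, h]⟩
  · rintro ⟨⟨p, hp, rfl⟩, hx⟩
    refine ⟨p, ⟨hp, fun r hr => ?_⟩, rfl⟩
    obtain ⟨_, ⟨s, hs, rfl⟩, h⟩ := hx _ (mem_image_of_mem f hr)
    exact ⟨s, hs, hf (by rw [hadd, hadd, h])⟩

/-- An idempotent of a minimal left ideal is a right identity for that ideal. -/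
theorem add_eq_of_mem_minimalPoints {p q : G} (hp : p ∈ minimalPoints P) (hq : q ∈ P)
    (hqq : q + q = q) (hqp : q + p = q) : p + q = p := by
  obtain ⟨s, -, h⟩ := hp.2 q hq
  rw [hqp] at h
  rw [← h, add_assoc, hqq]

variable [TopologicalSpace G] [CompactSpace G] [T2Space G]

/-- Every nonempty closed left ideal `L` of `P` contains a minimal closed left ideal of `P`, hence an
idempotent minimal point of `P`. -/
theorem exists_idempotent_minimalPoints (hcont : ∀ r : G, Continuous (· + r))
    {L : Set G} (hLc : IsClosed L)
    (hLne : L.Nonempty) (hLP : L ⊆ P) (hL : ∀ p ∈ P, ∀ x ∈ L, p + x ∈ L) :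
    ∃ q ∈ L, q ∈ minimalPoints P ∧ q + q = q := by
  let C : Set (Set G) := {N | IsClosed N ∧ N.Nonempty ∧ ∀ p ∈ P, ∀ x ∈ N, p + x ∈ N}
  obtain ⟨N, hNL, hN⟩ : ∃ N ⊆ L, Minimal (· ∈ C) N := by
    refine zorn_superset_nonempty C (fun c hcC hc hcne => ?_) L ⟨hLc, hLne, hL⟩
    refine ⟨⋂₀ c, ⟨isClosed_sInter fun s hs => (hcC hs).1, ?_, ?_⟩, 
      fun s hs => sInter_subset_of_mem hs⟩
    · have : Nonempty c := hcne.to_subtype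
      rw [sInter_eq_iInter]
      exact IsCompact.nonempty_iInter_of_directed_nonempty_isCompact_isClosed _
        (fun i j => (hc.total i.2 j.2).elim (fun h => ⟨i, subset_rfl, h⟩)
          (fun h => ⟨j, h, subset_rfl⟩))
        (fun i => (hcC i.2).2.1)
        (fun i => (hcC i.2).1.isCompact) (fun i => (hcC i.2).1)
    · intro p hp x hx s hs
      exact (hcC hs).2.2 p hp x (hx s hs)
  obtain ⟨hNc, hNne, hNl⟩ := hN.prop
  obtain ⟨q, hqN, hqq⟩ := exists_idempotent_in_compact_add_subsemigroup hcont N hNne hNc.isCompact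
    (fun x hx y hy => hNl x (hLP (hNL hx)) y hy)
  refine ⟨q, hNL hqN, ⟨hLP (hNL hqN), fun r hr => ?_⟩, hqq⟩
  have hsub : (· + (r + q)) '' N ⊆ N := by
    rintro _ ⟨x, hx, rfl⟩
    exact hNl x (hLP (hNL hx)) _ (hNl r hr q hqN)
  -- `N + r + q` is again a closed left ideal, so by minimality it is all of `N`.
  have hmem : (· + (r + q)) '' N ∈ C := by
    refine ⟨(hNc.isCompact.image (hcont _)).isClosed, hNne.image _, ?_⟩
    rintro p hp _ ⟨x, hx, rfl⟩
    exact ⟨p + x, hNl p hp x hx, add_assoc _ _ _⟩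
  obtain ⟨s, hs, h⟩ := hN.le_of_le hmem hsub hqN
  exact ⟨s, hLP (hNL hs), h⟩

/-- Every minimal point has a right identity among the idempotent minimal points. -/
theorem exists_idempotent_add_eq (hcont : ∀ r : G, Continuous (· + r))
    (hPc : IsClosed P) (hP : ∀ p ∈ P, ∀ q ∈ P, p + q ∈ P) {p : G} (hp : p ∈ minimalPoints P) :
    ∃ q ∈ minimalPoints P, q + q = q ∧ p + q = p := by
  obtain ⟨q, ⟨x, hx, rfl⟩, hq, hqq⟩ := exists_idempotent_minimalPoints (L := (· + p) '' P) hcont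
    (hPc.isCompact.image (hcont p)).isClosed (Set.Nonempty.image _ ⟨p, hp.1⟩)
    (by rintro _ ⟨x, hx, rfl⟩; exact hP x hx p hp.1)
    (by rintro r hr _ ⟨x, hx, rfl⟩; exact ⟨r + x, hP r hr x hx, add_assoc _ _ _⟩)
  refine ⟨_, hq, hqq, ?_⟩
  obtain ⟨s, -, h⟩ := hp.2 x hx
  calc p + (x + p) = s + (x + p) + (x + p) := by rw [h]
    _ = p := by rw [add_assoc, hqq, h]

end Algebra

/-! ### Ultrafilters converging to an idempotent -/

attribute [local instance] Ultrafilter.addSemigroup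

/-- The ultrafilters on `T` that contain `S` and converge to `e`.  They correspond to the elements
of `e_S^*`; viewing all of them as ultrafilters on `T` lets one compare different subsemigroups and
apply coordinate projections. -/
def convergentUltrafilters {T : Type*} [TopologicalSpace T] (S : Set T) (e : T) :
    Set (Ultrafilter T) :=
  {p | S ∈ p ∧ (p : Filter T) ≤ 𝓝 e}

section Ultrafilters

variable {T : Type*}

theorem mem_ultrafilter_add [AddSemigroup T] {p q : Ultrafilter T} {A : Set T} :
    A ∈ p + q ↔ ∀ᶠ s in (p : Filter T), ∀ᶠ t in (q : Filter T), s + t ∈ A :=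
  Iff.rfl

theorem ultrafilter_map_add {T' : Type*} [AddSemigroup T] [AddSemigroup T'] (f : T → T')
    (hf : ∀ s t, f (s + t) = f s + f t) (p q : Ultrafilter T) :
    (p + q).map f = p.map f + q.map f := by
  ext A
  rw [Ultrafilter.mem_map, mem_ultrafilter_add, mem_ultrafilter_add, Ultrafilter.coe_map,
    Ultrafilter.coe_map, eventually_map]
  simp only [eventually_map, mem_preimage, hf]

theorem add_mem_ultrafilter_add [AddSemigroup T] {p q : Ultrafilter T} {A B C : Set T} (hA : A ∈ p)
    (hB : B ∈ q) (h : ∀ a ∈ A, ∀ b ∈ B, a + b ∈ C) : C ∈ p + q := by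
  rw [mem_ultrafilter_add]
  filter_upwards [hA] with a ha
  filter_upwards [hB] with b hb using h a ha b hb

variable [TopologicalSpace T]

theorem isClosed_convergentUltrafilters (S : Set T) (e : T) :
    IsClosed (convergentUltrafilters S e) := by
  have : convergentUltrafilters S e =
      {p : Ultrafilter T | S ∈ p} ∩ ⋂ U ∈ 𝓝 e, {p : Ultrafilter T | U ∈ p} := by
    ext p
    simp [convergentUltrafilters, Filter.le_def]
  rw [this]
  exact (ultrafilter_isClosed_basic S).inter
    (isClosed_biInter fun U _ => ultrafilter_isClosed_basic U)

theorem exists_convergentUltrafilters_mem {S : Set T} {e : T} (h : e ∈ closure S) :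
    ∃ p, p ∈ convergentUltrafilters S e := by
  obtain ⟨p, h1, h2⟩ := mem_closure_iff_ultrafilter.1 h
  exact ⟨p, h1, h2⟩

variable [AddSemigroup T]

theorem ultrafilter_add_le_nhds [SeparatelyContinuousAdd T] {e : T} (he : e + e = e)
    {p q : Ultrafilter T} (hp : (p : Filter T) ≤ 𝓝 e) (hq : (q : Filter T) ≤ 𝓝 e) :
    ((p + q : Ultrafilter T) : Filter T) ≤ 𝓝 e := by
  intro U hU
  obtain ⟨V, hVU, hV, heV⟩ := mem_nhds_iff.1 hU
  have h1 : ∀ᶠ s in 𝓝 e, s + e ∈ V :=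
    (continuous_add_const e).continuousAt.eventually_mem (hV.mem_nhds (by rwa [he]))
  change ∀ᶠ s in (p : Filter T), ∀ᶠ t in (q : Filter T), s + t ∈ U
  filter_upwards [hp h1] with s hs
  have h2 : ∀ᶠ t in 𝓝 e, s + t ∈ V :=
    (continuous_const_add s).continuousAt.eventually_mem (hV.mem_nhds hs)
  filter_upwards [hq h2] with t ht using hVU ht

theorem add_mem_convergentUltrafilters [SeparatelyContinuousAdd T] {e : T} (he : e + e = e)
    {A B C : Set T} (h : ∀ a ∈ A, ∀ b ∈ B, a + b ∈ C) {p q : Ultrafilter T}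
    (hp : p ∈ convergentUltrafilters A e) (hq : q ∈ convergentUltrafilters B e) :
    p + q ∈ convergentUltrafilters C e :=
  ⟨add_mem_ultrafilter_add hp.1 hq.1 h, ultrafilter_add_le_nhds he hp.2 hq.2⟩

theorem add_mem_convergentUltrafilters_self [SeparatelyContinuousAdd T]
    {S : AddSubsemigroup T} {e : T} (he : e + e = e) :
    ∀ p ∈ convergentUltrafilters (S : Set T) e, ∀ q ∈ convergentUltrafilters (S : Set T) e,
      p + q ∈ convergentUltrafilters (S : Set T) e :=
  fun _ hp _ hq => add_mem_convergentUltrafilters he (fun _ ha _ hb => S.add_mem ha hb) hp hq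

theorem minimalPoints_convergentUltrafilters_nonempty [SeparatelyContinuousAdd T]
    {S : AddSubsemigroup T} {e : T} (hS : IsNear S e) :
    (minimalPoints (convergentUltrafilters (S : Set T) e)).Nonempty := by
  obtain ⟨q, -, hq, -⟩ := exists_idempotent_minimalPoints Ultrafilter.continuous_add_left
    (isClosed_convergentUltrafilters (S : Set T) e)
    (exists_convergentUltrafilters_mem hS.mem_closure) subset_rfl
    (add_mem_convergentUltrafilters_self hS.idem)
  exact ⟨q, hq⟩

theorem image_nearUltrafilters (S : AddSubsemigroup T) (e : T) :
    Ultrafilter.map ((↑) : S → T) '' nearUltrafilters S e =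
      convergentUltrafilters (S : Set T) e := by
  ext p
  constructor
  · rintro ⟨p, hp, rfl⟩
    refine ⟨?_, fun U hU => ?_⟩
    · rw [Ultrafilter.mem_map]
      exact univ_mem' fun s => s.2
    · rw [Ultrafilter.mem_coe, Ultrafilter.mem_map]
      by_contra h
      rw [← Ultrafilter.compl_mem_iff_notMem] at h
      obtain ⟨x, hx, s, hs, rfl⟩ := mem_closure_iff_nhds.1 (hp _ h) U hU
      exact hs hx
  · rintro ⟨hS, hp⟩
    have hrange : range ((↑) : S → T) ∈ p := by simpa using hS
    refine ⟨p.comap Subtype.val_injective hrange, fun A hA => ?_, ?_⟩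
    · rw [mem_closure_iff_ultrafilter]
      refine ⟨p, ?_, hp⟩
      rw [← Ultrafilter.mem_coe, Ultrafilter.coe_comap, mem_comap] at hA
      obtain ⟨t, ht, htA⟩ := hA
      filter_upwards [ht, hS] with x hx hxS
      exact ⟨⟨x, hxS⟩, htA hx, rfl⟩
    · apply Ultrafilter.coe_injective
      rw [Ultrafilter.coe_map, Ultrafilter.coe_comap, map_comap_of_mem hrange]

theorem image_smallestIdeal_nearUltrafilters [SeparatelyContinuousAdd T] {S : AddSubsemigroup T}
    {e : T} (hS : IsNear S e) :
    Ultrafilter.map ((↑) : S → T) '' smallestIdeal (nearUltrafilters S e) =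
      minimalPoints (convergentUltrafilters (S : Set T) e) := by
  have hinj : Function.Injective (Ultrafilter.map ((↑) : S → T)) := fun p q h => by
    apply Ultrafilter.coe_injective
    apply Filter.map_injective Subtype.val_injective
    rw [← Ultrafilter.coe_map, ← Ultrafilter.coe_map, h]
  have hadd := ultrafilter_map_add ((↑) : S → T) (fun _ _ => rfl)
  have him := image_minimalPoints _ hinj hadd (nearUltrafilters S e)
  rw [image_nearUltrafilters] at him
  rw [smallestIdeal_eq_minimalPoints, him]
  · intro p hp q hq
    have := add_mem_convergentUltrafilters_self (S := S) hS.idem _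
      (image_nearUltrafilters S e ▸ mem_image_of_mem _ hp) _
      (image_nearUltrafilters S e ▸ mem_image_of_mem _ hq)
    rw [← hadd, ← image_nearUltrafilters] at this
    exact hinj.mem_set_image.1 this
  · have := minimalPoints_convergentUltrafilters_nonempty hS
    rw [← him] at this
    exact this.of_image

theorem isCentral_iff [SeparatelyContinuousAdd T] {S : AddSubsemigroup T} {e : T}
    (hS : IsNear S e) {A : Set T} :
    IsCentral S e A ↔
      ∃ p ∈ minimalPoints (convergentUltrafilters (S : Set T) e), p + p = p ∧ A ∈ p := by
  have hadd := ultrafilter_map_add ((↑) : S → T) (fun _ _ => rfl)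
  rw [← image_smallestIdeal_nearUltrafilters hS]
  constructor
  · rintro ⟨p, hp, hpp, hA⟩
    exact ⟨_, mem_image_of_mem _ hp, by rw [← hadd, hpp], hA⟩
  · rintro ⟨_, ⟨p, hp, rfl⟩, hpp, hA⟩
    refine ⟨p, hp, ?_, hA⟩
    rw [← hadd] at hpp
    apply Ultrafilter.coe_injective
    apply Filter.map_injective Subtype.val_injective
    rw [← Ultrafilter.coe_map, hpp, Ultrafilter.coe_map]

end Ultrafilters

/-! ### Piecewise syndetic sets and the smallest ideal -/

section PiecewiseSyndetic

variable {T : Type*} [AddSemigroup T] [TopologicalSpace T] {S : AddSubsemigroup T} {e : T}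
  {A : Set T}

theorem IsPiecewiseSyndetic.exists_mem_minimalPoints [SeparatelyContinuousAdd T] (hS : IsNear S e)
    (hA : IsPiecewiseSyndetic S e A) :
    ∃ p ∈ minimalPoints (convergentUltrafilters (S : Set T) e), A ∈ p := by
  classical
  obtain ⟨W, hW, F, V, hFV, h⟩ := hA
  have hx : ∀ a : Finset S × ℕ, ∃ x ∈ W a.2 ∩ S, ∀ n, ∀ y ∈ a.1, (y : T) ∈ V n →
      ∃ t ∈ F n, t + (y + x) ∈ A := by
    rintro ⟨G, k⟩
    obtain ⟨y₀, -, hy₀⟩ := mem_closure_iff_nhds.1 hS.mem_closure univ univ_mem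
    obtain ⟨x, hx, hx'⟩ := h (insert y₀ (G.image (↑))) (Finset.insert_nonempty _ _) (by
      intro y hy
      rcases Finset.mem_insert.1 (Finset.mem_coe.1 hy) with rfl | hy
      · exact hy₀
      · obtain ⟨z, -, rfl⟩ := Finset.mem_image.1 hy
        exact z.2) (W k) (hW.mem k)
    refine ⟨x, hx, fun n y hy hyV => hx' n y ⟨?_, hyV⟩⟩
    exact Finset.mem_coe.2 (Finset.mem_insert_of_mem (Finset.mem_image_of_mem _ hy))
  choose x hxS hx using hx
  -- `r` is a limit of the translating elements `x` along the directed set of pairs `(G, W k)`.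
  let r : Ultrafilter T := Ultrafilter.of (map x atTop)
  have hr : (r : Filter T) ≤ map x atTop := Ultrafilter.of_le _
  have hrP : r ∈ convergentUltrafilters (S : Set T) e := by
    refine ⟨hr (mem_map.2 (univ_mem' fun a => (hxS a).2)),
      hW.toHasBasis.ge_iff.2 fun k _ => hr (mem_map.2 ?_)⟩
    filter_upwards [eventually_ge_atTop ((∅ : Finset S), k)] with a ha
    exact hW.antitone ha.2 (hxS a).1
  have hrA : ∀ n, ∀ y ∈ S, y ∈ V n → ∀ᶠ z in (r : Filter T), ∃ t ∈ F n, t + (y + z) ∈ A := by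
    intro n y hy hyV
    refine hr (mem_map.2 ?_)
    filter_upwards [eventually_ge_atTop (({⟨y, hy⟩} : Finset S), 0)] with a ha
    exact hx a n ⟨y, hy⟩ (ha.1 (Finset.mem_singleton_self _)) hyV
  -- For `v ∈ K`, some `t n ∈ F n` satisfies `A ∈ t n + (v + r)`; then `A ∈ u + (v + r)` for every
  -- limit `u` of the sequence `t`.
  obtain ⟨v, hv⟩ := minimalPoints_convergentUltrafilters_nonempty hS
  have hw := minimalPoints_add_mem (add_mem_convergentUltrafilters_self hS.idem) hrP hv
  have ht : ∀ n, ∃ t ∈ F n, {z | t + z ∈ A} ∈ v + r := by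
    intro n
    have : (⋃ t ∈ (F n : Set T), {z | t + z ∈ A}) ∈ v + r := by
      rw [mem_ultrafilter_add]
      filter_upwards [hv.1.1, hv.1.2 (hFV n).2.2.1] with y hy hyV
      filter_upwards [hrA n y hy hyV] with z hz
      simpa using hz
    rwa [Ultrafilter.finite_biUnion_mem_iff (F n).finite_toSet] at this
  choose t htF htA using ht
  let u : Ultrafilter T := Ultrafilter.of (map t atTop)
  have hu : (u : Filter T) ≤ map t atTop := Ultrafilter.of_le _
  have huP : u ∈ convergentUltrafilters (S : Set T) e := by
    refine ⟨hu (mem_map.2 (univ_mem' fun n => ((hFV n).2.1 (htF n)).2)),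
      hW.toHasBasis.ge_iff.2 fun k _ => hu (mem_map.2 ?_)⟩
    filter_upwards [eventually_ge_atTop k] with n hn
    exact hW.antitone hn ((hFV n).2.1 (htF n)).1
  refine ⟨u + (v + r),
    add_mem_minimalPoints (add_mem_convergentUltrafilters_self hS.idem) huP hw, ?_⟩
  rw [mem_ultrafilter_add]
  exact hu (mem_map.2 (univ_mem' htA))

theorem isPiecewiseSyndetic_of_mem_minimalPoints [T1Space T] [(𝓝 e).IsCountablyGenerated]
    (hS : IsNear S e) {p : Ultrafilter T}
    (hp : p ∈ minimalPoints (convergentUltrafilters (S : Set T) e)) (hA : A ∈ p) :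
    IsPiecewiseSyndetic S e A := by
  obtain ⟨W, hW⟩ := (𝓝 e).exists_antitone_basis
  let C : T → Set T := fun t => {y | ∀ᶠ x in (p : Filter T), t + (y + x) ∈ A}
  have key : ∀ n, ∃ (F : Finset T) (V : Set T), (F.Nonempty ∧ (F : Set T) ⊆ W n ∩ S ∧ V ∈ 𝓝 e ∧
      V ⊆ W n) ∧ ∀ y ∈ S, y ∈ V → ∃ t ∈ F, y ∈ C t := by
    classical
    intro n
    have hcov : ∀ v ∈ convergentUltrafilters (S : Set T) e, ∃ t ∈ W n ∩ (S : Set T), C t ∈ v := by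
      intro v hv
      obtain ⟨s, hs, h⟩ := hp.2 v hv
      rw [← h, mem_ultrafilter_add] at hA
      obtain ⟨t, htA, htW, htS⟩ := (hA.and (inter_mem (hs.2 (hW.mem n)) hs.1)).exists
      exact ⟨t, ⟨htW, htS⟩, htA⟩
    -- By compactness finitely many of the clopen sets given by the `C t` cover `e_S^*`, so the union
    -- of these `C t` contains the trace on `S` of a neighbourhood of `e`.
    obtain ⟨b, hb, hbf, hbc⟩ :=
      (isClosed_convergentUltrafilters (S : Set T) e).isCompact.elim_finite_subcover_image
        (b := W n ∩ (S : Set T)) (c := fun t => {v | C t ∈ v})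
        (fun t _ => ultrafilter_isOpen_basic _) (fun v hv => by simpa using hcov v hv)
    have hmem : (⋃ t ∈ b, C t) ∈ 𝓝[(S : Set T)] e := by
      rw [mem_iff_ultrafilter]
      intro v hv
      rw [nhdsWithin, le_inf_iff, le_principal_iff] at hv
      rw [Ultrafilter.finite_biUnion_mem_iff hbf]
      simpa using hbc ⟨hv.2, hv.1⟩
    obtain ⟨t₀, ht₀⟩ := mem_closure_iff_nhds.1 hS.mem_closure (W n) (hW.mem n)
    refine ⟨insert t₀ hbf.toFinset, W n ∩ {y | y ∈ S → y ∈ ⋃ t ∈ b, C t},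
      ⟨Finset.insert_nonempty _ _, ?_, inter_mem (hW.mem n) (mem_inf_principal.1 hmem),
        inter_subset_left⟩, fun y hy hyV => ?_⟩
    · intro t ht
      rcases Finset.mem_insert.1 (Finset.mem_coe.1 ht) with rfl | ht
      · exact ht₀
      · exact hb (hbf.mem_toFinset.1 ht)
    · obtain ⟨t, ht, hyt⟩ := mem_iUnion₂.1 (hyV.2 hy)
      exact ⟨t, Finset.mem_insert_of_mem (hbf.mem_toFinset.2 ht), hyt⟩
  choose F V hFV hC using key
  refine ⟨W, hW, F, V, hFV, fun G _ hGS O hO => ?_⟩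
  -- Each `y ∈ G` differs from `e`, so it lies in only finitely many of the sets `V n`.
  have hfin : ∀ y ∈ G, ∀ᶠ x in (p : Filter T), ∀ n, y ∈ V n → ∃ t ∈ F n, t + (y + x) ∈ A := by
    intro y hy
    have hye : y ≠ e := fun h => hS.notMem (h ▸ hGS hy)
    obtain ⟨N, hN⟩ := hW.mem_iff.1 (compl_singleton_mem_nhds hye.symm)
    have : ∀ᶠ x in (p : Filter T), ∀ n ∈ Finset.range N, y ∈ V n → ∃ t ∈ F n, t + (y + x) ∈ A := by
      rw [Filter.eventually_all_finset]
      intro n _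
      by_cases hyV : y ∈ V n
      · obtain ⟨t, ht, h⟩ := hC n y (hGS hy) hyV
        exact h.mono fun x hx _ => ⟨t, ht, hx⟩
      · exact Eventually.of_forall fun x h => absurd h hyV
    filter_upwards [this] with x hx n hyV
    refine hx n (Finset.mem_range.2 ?_) hyV
    by_contra! hNn
    exact hN (hW.antitone hNn ((hFV n).2.2.2 hyV)) rfl
  rw [← Filter.eventually_all_finset] at hfin
  obtain ⟨x, hx, hxO, hxS⟩ := (hfin.and (inter_mem (hp.1.2 hO) hp.1.1)).exists
  exact ⟨x, ⟨hxO, hxS⟩, fun n y hy => hx y hy.1 n hy.2⟩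

theorem IsCentralStar.mem_of_minimalPoints [SeparatelyContinuousAdd T] (hS : IsNear S e)
    (hA : IsCentralStar S e A) {p : Ultrafilter T}
    (hp : p ∈ minimalPoints (convergentUltrafilters (S : Set T) e))
    (hpp : p + p = p) : A ∈ p := by
  by_contra h
  rw [← Ultrafilter.compl_mem_iff_notMem] at h
  obtain ⟨x, hx, -, hx'⟩ := hA (S ∩ Aᶜ) inter_subset_left
    ((isCentral_iff hS).2 ⟨p, hp, hpp, inter_mem hp.1.1 h⟩)
  exact hx' hx

theorem IsPSStar.mem_of_minimalPoints [T1Space T] [(𝓝 e).IsCountablyGenerated]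
    (hS : IsNear S e) (hA : IsPSStar S e A)
    {p : Ultrafilter T} (hp : p ∈ minimalPoints (convergentUltrafilters (S : Set T) e)) :
    A ∈ p := by
  by_contra h
  rw [← Ultrafilter.compl_mem_iff_notMem] at h
  obtain ⟨x, hx, -, hx'⟩ := hA (S ∩ Aᶜ) inter_subset_left
    (isPiecewiseSyndetic_of_mem_minimalPoints hS hp (inter_mem hp.1.1 h))
  exact hx' hx

end PiecewiseSyndetic

/-! ### Idempotent ultrafilters and finite sums -/

section FiniteSums

variable {M : Type*} [AddSemigroup M]

/-- A strengthening of `Hindman.exists_idempotent_ultrafilter_le_FS`: the idempotent contains the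
finite sums of every tail. -/
theorem exists_idempotent_ultrafilter_forall_FS_drop (a : Stream' M) :
    ∃ U : Ultrafilter M, U + U = U ∧ ∀ n, Hindman.FS (a.drop n) ∈ U := by
  let S : Set (Ultrafilter M) := ⋂ n, {U | Hindman.FS (a.drop n) ∈ U}
  obtain ⟨U, hU, hUU⟩ : ∃ U ∈ S, U + U = U := by
    refine exists_idempotent_in_compact_add_subsemigroup Ultrafilter.continuous_add_left S ?_ ?_ ?_
    · apply IsCompact.nonempty_iInter_of_sequence_nonempty_isCompact_isClosed
      · intro n U hU
        refine mem_of_superset (mem_ofPred_eq ▸ hU) ?_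
        rw [← Stream'.drop_drop, ← Stream'.tail_eq_drop]
        exact Hindman.FS.tail _
      · exact fun n => ⟨pure _, mem_pure.mpr (Hindman.FS.head _)⟩
      · exact (ultrafilter_isClosed_basic _).isCompact
      · exact fun n => ultrafilter_isClosed_basic _
    · exact (isClosed_iInter fun i => ultrafilter_isClosed_basic _).isCompact
    · intro U hU V hV
      refine mem_iInter.2 fun n => ?_
      change ∀ᶠ m in (U : Filter M), ∀ᶠ m' in (V : Filter M), m + m' ∈ Hindman.FS (a.drop n)
      filter_upwards [mem_iInter.1 hU n] with m hm
      obtain ⟨n', hn⟩ := Hindman.FS.add hm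
      filter_upwards [mem_iInter.1 hV (n' + n)] with m' hm'
      apply hn
      simpa only [Stream'.drop_drop, add_comm] using hm'
  exact ⟨U, hUU, mem_iInter.1 hU⟩

/-- A strengthening of `Hindman.exists_FS_of_large`: given countably many members `D n` of an
idempotent ultrafilter, the sequence can be chosen so that the finite sums of its `n`-th tail lie
in `D n`. -/
theorem exists_forall_FS_drop_subset (U : Ultrafilter M) (hU : U + U = U) (D : ℕ → Set M)
    (hD : ∀ n, D n ∈ U) : ∃ a : Stream' M, ∀ n, Hindman.FS (a.drop n) ⊆ D n := by
  have exists_elem : ∀ {s : Set M}, s ∈ U →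
      (s ∩ {m | ∀ᶠ m' in (U : Filter M), m + m' ∈ s}).Nonempty :=
    fun {s} hs => Ultrafilter.nonempty_of_mem (inter_mem hs (by rwa [← hU] at hs))
  -- A state consists of the set in which all further sums must lie and the current index.
  let elem : {s // s ∈ U} × ℕ → M := fun p => (exists_elem p.1.2).some
  have hmem : ∀ p, elem p ∈ p.1.1 := fun p => (exists_elem p.1.2).some_mem.1
  have hadd : ∀ p, ∀ᶠ m in (U : Filter M), elem p + m ∈ p.1.1 :=
    fun p => (exists_elem p.1.2).some_mem.2
  let succ : {s // s ∈ U} × ℕ → {s // s ∈ U} × ℕ := fun p =>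
    (⟨(p.1.1 ∩ {m | elem p + m ∈ p.1.1}) ∩ D (p.2 + 1),
      inter_mem (inter_mem p.1.2 (hadd p)) (hD _)⟩, p.2 + 1)
  have hFS : ∀ a : Stream' M, ∀ m ∈ Hindman.FS a, ∀ p, a = Stream'.corec elem succ p →
      m ∈ p.1.1 := by
    intro a m h
    induction h with
    | head' b =>
      rintro p rfl
      rw [Stream'.corec_eq, Stream'.head_cons]
      exact hmem p
    | tail' b n h ih =>
      rintro p rfl
      exact (ih (succ p) (by rw [Stream'.corec_eq, Stream'.tail_cons])).1.1
    | cons' b n h ih =>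
      rintro p rfl
      have := (ih (succ p) (by rw [Stream'.corec_eq, Stream'.tail_cons])).1.2
      rw [Stream'.corec_eq, Stream'.head_cons]
      exact this
  let p₀ : {s // s ∈ U} × ℕ := (⟨D 0, hD 0⟩, 0)
  have hdrop : ∀ n, ∃ p : {s // s ∈ U} × ℕ, p.2 = n ∧ p.1.1 ⊆ D n ∧
      (Stream'.corec elem succ p₀).drop n = Stream'.corec elem succ p := by
    intro n
    induction n with
    | zero => exact ⟨p₀, rfl, subset_rfl, rfl⟩
    | succ n ih =>
      obtain ⟨p, rfl, -, h⟩ := ih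
      refine ⟨succ p, rfl, inter_subset_right, ?_⟩
      rw [← Stream'.tail_drop', h, Stream'.corec_eq, Stream'.tail_cons]
  refine ⟨Stream'.corec elem succ p₀, fun n m hm => ?_⟩
  obtain ⟨p, -, hp, h⟩ := hdrop n
  exact hp (hFS _ m hm p h)

theorem FS_map {N : Type*} [AddSemigroup N] (f : M → N) (hf : ∀ a b, f (a + b) = f a + f b)
    (x : Stream' M) : Hindman.FS (x.map f) ⊆ f '' Hindman.FS x := by
  intro m hm
  generalize hy : x.map f = y at hm
  induction hm generalizing x with
  | head' b =>
    subst hy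
    exact ⟨_, Hindman.FS.head x, rfl⟩
  | tail' b n h ih =>
    subst hy
    obtain ⟨z, hz, rfl⟩ := ih x.tail rfl
    exact ⟨z, Hindman.FS.tail _ _ hz, rfl⟩
  | cons' b n h ih =>
    subst hy
    obtain ⟨z, hz, rfl⟩ := ih x.tail rfl
    exact ⟨_, Hindman.FS.cons _ _ hz, hf _ _⟩

end FiniteSums

/-! ### Subsemigroups of powers and coordinate projections -/

section Powers

variable {T ι : Type*}

theorem separatelyContinuousAdd_pi [Add T] [TopologicalSpace T] [SeparatelyContinuousAdd T] :
    SeparatelyContinuousAdd (ι → T) where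
  continuous_const_add := continuous_pi fun i =>
    (continuous_const_add _).comp (continuous_apply i)
  continuous_add_const := continuous_pi fun i =>
    (continuous_add_const _).comp (continuous_apply i)

attribute [local instance] separatelyContinuousAdd_pi

theorem map_eval_add [AddSemigroup T] (i : ι) (p q : Ultrafilter (ι → T)) :
    (p + q).map (fun x => x i) = p.map (fun x => x i) + q.map (fun x => x i) :=
  ultrafilter_map_add _ (fun _ _ => rfl) p q

theorem map_const_mem_convergentUltrafilters [TopologicalSpace T] {p : Ultrafilter T}
    {A : Set T} {e : T} (hp : p ∈ convergentUltrafilters A e) :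
    p.map (fun a (_ : ι) => a) ∈
      convergentUltrafilters ((fun a (_ : ι) => a) '' A) (fun _ => e) := by
  have hc : Continuous (fun a (_ : ι) => a : T → ι → T) := continuous_pi fun _ => continuous_id
  exact ⟨image_mem_map hp.1, (Filter.map_mono hp.2).trans hc.continuousAt⟩

theorem map_eval_map_const (i : ι) (p : Ultrafilter T) :
    (p.map (fun a (_ : ι) => a)).map (fun x => x i) = p := by
  rw [Ultrafilter.map_map]
  exact Ultrafilter.map_id p

theorem pi_inter_mem [Finite ι] {B : Set T} {I : Set (ι → T)} {q : Ultrafilter (ι → T)} (hI : I ∈ q)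
    (h : ∀ i, B ∈ q.map (fun x => x i)) : univ.pi (fun _ => B) ∩ I ∈ q := by
  refine inter_mem ?_ hI
  have : univ.pi (fun _ => B) = ⋂ i, (fun x : ι → T => x i) ⁻¹' B := by
    ext x; simp
  rw [this]
  exact iInter_mem.2 h

/-- Under `hproj`, every ultrafilter on `π_i[I]` converging to `e` lifts to an ultrafilter on `I`
converging to `(e, …, e)`. -/
theorem exists_convergentUltrafilters_map_eq [TopologicalSpace T] {e : T}
    {I : Set (ι → T)} (i : ι)
    (hproj : ∀ D ⊆ (fun x : ι → T => x i) '' I, e ∈ closure D →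
      (fun _ => e) ∈ closure (I ∩ (fun x : ι → T => x i) ⁻¹' D))
    {p : Ultrafilter T} (hp : p ∈ convergentUltrafilters ((fun x : ι → T => x i) '' I) e) :
    ∃ q ∈ convergentUltrafilters I (fun _ => e), q.map (fun x => x i) = p := by
  have hne : NeBot (comap (fun x : ι → T => x i) p ⊓ 𝓝[I] (fun _ => e)) := by
    rw [inf_neBot_iff]
    intro X hX Y hY
    obtain ⟨D, hD, hDX⟩ := mem_comap.1 hX
    obtain ⟨U, hU, hUY⟩ := mem_nhdsWithin_iff_exists_mem_nhds_inter.1 hY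
    have hmem : D ∩ (fun x : ι → T => x i) '' I ∈ p := inter_mem hD hp.1
    obtain ⟨x, hxU, hxI, hxD⟩ := mem_closure_iff_nhds.1 (hproj _ inter_subset_right
      (mem_closure_iff_ultrafilter.2 ⟨p, hmem, hp.2⟩)) U hU
    exact ⟨x, hDX hxD.1, hUY ⟨hxU, hxI⟩⟩
  let q := Ultrafilter.of (comap (fun x : ι → T => x i) p ⊓ 𝓝[I] (fun _ => e))
  have hq : (q : Filter (ι → T)) ≤ _ := Ultrafilter.of_le _
  refine ⟨q, ⟨?_, (hq.trans inf_le_right).trans inf_le_left⟩, ?_⟩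
  · exact le_principal_iff.1 ((hq.trans inf_le_right).trans inf_le_right)
  · apply Ultrafilter.eq_of_le
    rw [Ultrafilter.coe_map]
    exact map_le_iff_le_comap.2 (hq.trans inf_le_left)

variable [AddSemigroup T] [TopologicalSpace T] {S : AddSubsemigroup T} {e : T}
  {I : AddSubsemigroup (ι → T)}

theorem map_eval_mem_convergentUltrafilters (hIS : ∀ x ∈ I, ∀ i, x i ∈ S) (i : ι)
    {q : Ultrafilter (ι → T)} (hq : q ∈ convergentUltrafilters (I : Set (ι → T)) (fun _ => e)) :
    q.map (fun x => x i) ∈ convergentUltrafilters (S : Set T) e := by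
  refine ⟨Ultrafilter.mem_map.2 (mem_of_superset hq.1 fun x hx => hIS x hx i), ?_⟩
  exact (Filter.map_mono hq.2).trans (continuous_apply i).continuousAt

theorem IsIPStar.pi_inter [Finite ι] {B : Set T} (hIS : ∀ x ∈ I, ∀ i, x i ∈ S)
    (hB : IsIPStar S e B) :
    IsIPStar I (fun _ => e) (univ.pi (fun _ => B) ∩ (I : Set (ι → T))) := by
  rintro C hCI ⟨x, -, hxe, hxC⟩
  obtain ⟨q, hqq, hq⟩ := exists_idempotent_ultrafilter_forall_FS_drop x
  have hqC : C ∈ q := mem_of_superset (hq 0) hxC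
  have hqI : (I : Set (ι → T)) ∈ q := mem_of_superset hqC hCI
  refine Ultrafilter.nonempty_of_mem (inter_mem (pi_inter_mem hqI fun i => ?_) hqC)
  by_contra h
  rw [← Ultrafilter.compl_mem_iff_notMem, Ultrafilter.mem_map] at h
  obtain ⟨y, hy⟩ := exists_forall_FS_drop_subset q hqq
    (fun n => Hindman.FS (x.drop n) ∩ ((I : Set (ι → T)) ∩ (fun x => x i) ⁻¹' Bᶜ))
    (fun n => inter_mem (hq n) (inter_mem hqI h))
  have hFS : Hindman.FS (y.map (fun x => x i)) ⊆ (S : Set T) ∩ Bᶜ := by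
    refine (FS_map _ (fun _ _ => rfl) y).trans ?_
    rintro _ ⟨z, hz, rfl⟩
    exact ⟨hIS z (hy 0 hz).2.1 i, (hy 0 hz).2.2⟩
  have hconv : SumConvergesNear e (y.map (fun x => x i)) := by
    intro U hU
    obtain ⟨m, hm⟩ := hxe _ ((continuous_apply i).continuousAt.preimage_mem_nhds hU)
    refine ⟨m, ?_⟩
    rw [Stream'.drop_map]
    refine (FS_map _ (fun _ _ => rfl) (y.drop m)).trans ?_
    rintro _ ⟨w, hw, rfl⟩
    exact hm (hy m hw).1
  obtain ⟨z, hzB, -, hz⟩ := hB (S ∩ Bᶜ) inter_subset_left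
    ⟨y.map (fun x => x i), fun n => (hFS (Hindman.FS.singleton _ n)).1, hconv, hFS⟩
  exact hz hzB

variable [SeparatelyContinuousAdd T]

/-- A minimal idempotent `p` lifts to a minimal idempotent over `I` all of whose coordinate
projections are `p`. -/
theorem exists_idempotent_lift (he : e + e = e) (hI : IsNear I (fun _ => e))
    (hIS : ∀ x ∈ I, ∀ i, x i ∈ S) (hl : ∀ a ∈ S, ∀ x ∈ I, (fun _ => a) + x ∈ I)
    (hr : ∀ a ∈ S, ∀ x ∈ I, x + (fun _ => a) ∈ I) {p : Ultrafilter T}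
    (hp : p ∈ minimalPoints (convergentUltrafilters (S : Set T) e)) (hpp : p + p = p) :
    ∃ q ∈ minimalPoints (convergentUltrafilters (I : Set (ι → T)) (fun _ => e)),
      q + q = q ∧ ∀ i, q.map (fun x => x i) = p := by
  have hee : (fun _ : ι => e) + (fun _ : ι => e) = fun _ => e := funext fun _ => he
  set P := convergentUltrafilters (I : Set (ι → T)) (fun _ => e) with hP
  set d : Ultrafilter (ι → T) := p.map (fun a (_ : ι) => a) with hd
  have hdd : d + d = d := by
    rw [hd, ← ultrafilter_map_add (fun a (_ : ι) => a) (fun _ _ => rfl), hpp]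
  have hdP := map_const_mem_convergentUltrafilters (ι := ι) hp.1
  have hlP : ∀ x ∈ P, d + x ∈ P := fun x hx => add_mem_convergentUltrafilters hee
    (by rintro _ ⟨a, ha, rfl⟩ b hb; exact hl a ha b hb) hdP hx
  have hrP : ∀ x ∈ P, x + d ∈ P := fun x hx => add_mem_convergentUltrafilters hee
    (by rintro b hb _ ⟨a, ha, rfl⟩; exact hr a ha b hb) hx hdP
  have hadd : ∀ x ∈ P, ∀ y ∈ P, x + y ∈ P := add_mem_convergentUltrafilters_self hI.idem
  obtain ⟨_, ⟨x, hx, rfl⟩, hq, hqq⟩ := exists_idempotent_minimalPoints (P := P)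
    (L := (· + d) '' P) Ultrafilter.continuous_add_left
    ((isClosed_convergentUltrafilters _ _).isCompact.image
      (Ultrafilter.continuous_add_left d)).isClosed
    (Set.Nonempty.image _ (exists_convergentUltrafilters_mem hI.mem_closure))
    (by rintro _ ⟨y, hy, rfl⟩; exact hrP y hy)
    (by rintro y hy _ ⟨z, hz, rfl⟩; exact ⟨y + z, hadd y hy z hz, add_assoc _ _ _⟩)
  simp only at hq hqq
  set q := x + d with hqdef
  have hqd : q + d = q := by rw [hqdef, add_assoc, hdd]
  refine ⟨d + q, ⟨hlP q hq.1, fun r hr => ?_⟩, ?_, fun i => ?_⟩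
  · obtain ⟨s, hs, h⟩ := hq.2 (r + d) (hrP r hr)
    exact ⟨d + s, hlP s hs, by rw [← add_assoc r, add_assoc d, h]⟩
  · rw [add_assoc, ← add_assoc q, hqd, hqq]
  · have hproj := add_eq_of_mem_minimalPoints hp
      (map_eval_mem_convergentUltrafilters hIS i hq.1)
      (by rw [← map_eval_add, hqq])
      (by
        have := congrArg (Ultrafilter.map (fun x : ι → T => x i)) hqd
        rwa [map_eval_add, hd, map_eval_map_const] at this)
    rw [map_eval_add, hd, map_eval_map_const, hproj]

/-- Every minimal point `p` lifts to a minimal point over `I` all of whose coordinate projections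
are `p`. -/
theorem exists_minimalPoints_lift (he : e + e = e) (hI : IsNear I (fun _ => e))
    (hIS : ∀ x ∈ I, ∀ i, x i ∈ S) (hl : ∀ a ∈ S, ∀ x ∈ I, (fun _ => a) + x ∈ I)
    (hr : ∀ a ∈ S, ∀ x ∈ I, x + (fun _ => a) ∈ I) {p : Ultrafilter T}
    (hp : p ∈ minimalPoints (convergentUltrafilters (S : Set T) e)) :
    ∃ q ∈ minimalPoints (convergentUltrafilters (I : Set (ι → T)) (fun _ => e)),
      ∀ i, q.map (fun x => x i) = p := by
  have hee : (fun _ : ι => e) + (fun _ : ι => e) = fun _ => e := funext fun _ => he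
  obtain ⟨p₀, hp₀, hpp₀, hadd⟩ := exists_idempotent_add_eq Ultrafilter.continuous_add_left
    (isClosed_convergentUltrafilters (S : Set T) e)
    (add_mem_convergentUltrafilters_self he) hp
  obtain ⟨q, hq, hqq, hqp⟩ := exists_idempotent_lift he hI hIS hl hr hp₀ hpp₀
  have hmem : ∀ x ∈ convergentUltrafilters (I : Set (ι → T)) (fun _ => e),
      p.map (fun a (_ : ι) => a) + x ∈
        convergentUltrafilters (I : Set (ι → T)) (fun _ => e) := fun x hx =>
    add_mem_convergentUltrafilters hee
      (by rintro _ ⟨a, ha, rfl⟩ b hb; exact hl a ha b hb)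
      (map_const_mem_convergentUltrafilters hp.1) hx
  refine ⟨p.map (fun a (_ : ι) => a) + q, ?_, fun i => ?_⟩
  · -- Since `q` is idempotent, the new point is `(p + q) + q`, with the left summand over `I`.
    rw [← hqq, ← add_assoc]
    exact add_mem_minimalPoints (add_mem_convergentUltrafilters_self hI.idem) (hmem q hq.1) hq
  · rw [map_eval_add, map_eval_map_const, hqp, hadd]

/-- Coordinate projections of minimal points over `I` are minimal. -/
theorem map_eval_mem_minimalPoints (he : e + e = e) (hIS : ∀ x ∈ I, ∀ i, x i ∈ S)
    (hr : ∀ a ∈ S, ∀ x ∈ I, x + (fun _ => a) ∈ I) (i : ι)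
    (hproj : ∀ D ⊆ (fun x : ι → T => x i) '' (I : Set (ι → T)), e ∈ closure D →
      (fun _ => e) ∈ closure ((I : Set (ι → T)) ∩ (fun x : ι → T => x i) ⁻¹' D))
    {q : Ultrafilter (ι → T)}
    (hq : q ∈ minimalPoints (convergentUltrafilters (I : Set (ι → T)) (fun _ => e))) :
    q.map (fun x => x i) ∈ minimalPoints (convergentUltrafilters (S : Set T) e) := by
  have hqS := map_eval_mem_convergentUltrafilters hIS i hq.1
  refine ⟨hqS, fun r hrS => ?_⟩
  -- `π_i q + r` lives on the ideal `π_i[I]` of `S`, so it lifts to `I`.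
  have hqr : q.map (fun x => x i) + r ∈
      convergentUltrafilters ((fun x : ι → T => x i) '' (I : Set (ι → T))) e := by
    refine add_mem_convergentUltrafilters he ?_ ⟨image_mem_map hq.1.1, hqS.2⟩ hrS
    rintro _ ⟨x, hx, rfl⟩ a ha
    exact ⟨_, hr a ha x hx, rfl⟩
  obtain ⟨v, hv, hvq⟩ := exists_convergentUltrafilters_map_eq i hproj hqr
  obtain ⟨s, hs, h⟩ := hq.2 v hv
  refine ⟨s.map (fun x => x i) + q.map (fun x => x i),
    add_mem_convergentUltrafilters_self he _ (map_eval_mem_convergentUltrafilters hIS i hs) _ hqS,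
    ?_⟩
  have := congrArg (Ultrafilter.map (fun x : ι → T => x i)) h
  rw [map_eval_add, map_eval_add, hvq] at this
  rw [add_assoc, ← add_assoc _ r, this]

end Powers

end NearIdempotent

open Set Filter Topology NearIdempotent in
theorem theorem3p13 {T : Type*} [AddSemigroup T] [TopologicalSpace T] [T2Space T]
    [SeparatelyContinuousAdd T] (S : AddSubsemigroup T) (e : T)
    (hS : NearIdempotent.IsNear S e)
    (l : ℕ) (hl : 1 ≤ l)
    (E : AddSubsemigroup (Fin l → T))
    (hES : (E : Set (Fin l → T)) ⊆ Set.univ.pi (fun _ => (S : Set T)))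
    (hE : NearIdempotent.IsNear E (fun _ => e))
    (hdiag : ∀ a ∈ S, (fun _ => a) ∈ E)
    (I : AddSubsemigroup (Fin l → T))
    (hI : NearIdempotent.IsNear I (fun _ => e))
    (hIE : NearIdempotent.IsIdealOf (I : Set (Fin l → T)) (E : Set (Fin l → T)))
    (hproj : ∀ i : Fin l, ∀ D : Set T, D ⊆ (fun x : Fin l → T => x i) '' (I : Set (Fin l → T)) →
      e ∈ closure D →
      (fun _ => e) ∈ closure ((I : Set (Fin l → T)) ∩ (fun x : Fin l → T => x i) ⁻¹' D))
    (B : Set T) (hB : B ⊆ (S : Set T)) :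
    (NearIdempotent.IsCentral S e B →
      NearIdempotent.IsCentral I (fun _ => e)
        (Set.univ.pi (fun _ => B) ∩ (I : Set (Fin l → T)))) ∧
    ((nhds e).IsCountablyGenerated →
      NearIdempotent.IsPiecewiseSyndetic S e B →
      NearIdempotent.IsPiecewiseSyndetic I (fun _ => e)
        (Set.univ.pi (fun _ => B) ∩ (I : Set (Fin l → T)))) ∧
    ((nhds e).IsCountablyGenerated →
      NearIdempotent.IsCentralStar S e B →
      NearIdempotent.IsCentralStar I (fun _ => e)
        (Set.univ.pi (fun _ => B) ∩ (I : Set (Fin l → T)))) ∧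
    ((nhds e).IsCountablyGenerated →
      NearIdempotent.IsPSStar S e B →
      NearIdempotent.IsPSStar I (fun _ => e)
        (Set.univ.pi (fun _ => B) ∩ (I : Set (Fin l → T)))) ∧
    (NearIdempotent.IsIPStar S e B →
      NearIdempotent.IsIPStar I (fun _ => e)
        (Set.univ.pi (fun _ => B) ∩ (I : Set (Fin l → T)))) := by
  have hcont := separatelyContinuousAdd_pi (T := T) (ι := Fin l)
  have hIS : ∀ x ∈ I, ∀ i, x i ∈ S := fun x hx i => hES (hIE.subset hx) i (mem_univ i)
  have hl' : ∀ a ∈ S, ∀ x ∈ I, (fun _ => a) + x ∈ I := fun a ha x hx =>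
    hIE.left_mem _ (hdiag a ha) x hx
  have hr' : ∀ a ∈ S, ∀ x ∈ I, x + (fun _ => a) ∈ I := fun a ha x hx =>
    hIE.right_mem _ (hdiag a ha) x hx
  have hcg : (𝓝 e).IsCountablyGenerated → (𝓝 (fun _ : Fin l => e)).IsCountablyGenerated := by
    intro h
    rw [nhds_pi]
    infer_instance
  refine ⟨fun h => ?_, fun hc h => ?_, fun _ h C hCI hC => ?_, fun hc h C hCI hC => ?_,
    fun h => h.pi_inter hIS⟩
  · obtain ⟨p, hp, hpp, hBp⟩ := (isCentral_iff hS).1 h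
    obtain ⟨q, hq, hqq, hqp⟩ := exists_idempotent_lift hS.idem hI hIS hl' hr' hp hpp
    exact (isCentral_iff hI).2 ⟨q, hq, hqq, pi_inter_mem hq.1.1 fun i => by rwa [hqp i]⟩
  · have := hcg hc
    obtain ⟨p, hp, hBp⟩ := h.exists_mem_minimalPoints hS
    obtain ⟨q, hq, hqp⟩ := exists_minimalPoints_lift hS.idem hI hIS hl' hr' hp
    exact isPiecewiseSyndetic_of_mem_minimalPoints hI hq
      (pi_inter_mem hq.1.1 fun i => by rwa [hqp i])
  · obtain ⟨q, hq, hqq, hCq⟩ := (isCentral_iff hI).1 hC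
    refine Ultrafilter.nonempty_of_mem (inter_mem (pi_inter_mem hq.1.1 fun i => ?_) hCq)
    exact h.mem_of_minimalPoints hS
      (map_eval_mem_minimalPoints hS.idem hIS hr' i (hproj i) hq) (by rw [← map_eval_add, hqq])
  · obtain ⟨q, hq, hCq⟩ := hC.exists_mem_minimalPoints hI
    refine Ultrafilter.nonempty_of_mem (inter_mem (pi_inter_mem hq.1.1 fun i => ?_) hCq)
    exact h.mem_of_minimalPoints hS (map_eval_mem_minimalPoints hS.idem hIS hr' i (hproj i) hq)
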